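/- **Conventions.** A *Boolean algebra* $\mathcal B$ is a relatively complemented distributive lattice with least element $\emptyset$, not necessarily unital. An *ideal* of $\mathcal B$ is a non-empty, lower closed subset that is closed under finite unions; $\widehat{\mathcal B}$ is the set of ultrafilters of $\mathcal B$ (maximal filters; filters are non-empty and do not contain $\emptyset$), with the topology generated by the sets $Z(A)=\{\xi\in\widehat{\mathcal B}: A\in\xi\}$, $A\in\mathcal B$. A *Boolean dynamical system* $(\mathcal B,\mathcal L,\theta)$ consists of a Boolean algebra $\mathcal B$, a set $\mathcal L$ and maps $\theta_\alpha:\mathcal B\to\mathcal B$ ($\alpha\in\mathcal L$) that preserve $\cap$, $\cup$, $\setminus$ and $\emptyset$. For a word $\beta=\beta_1\cdots\beta_n$ put $\theta_\beta=\theta_{\beta_n}\circ\cdots\circ\theta_{\beta_1}$, and $\beta_{1,t}=\beta_1\cdots\beta_t$. For $A\in\mathcal B$ put $\Delta_A=\{\alpha\in\mathcal L:\theta_\alpha(A)\ne\emptyset\}$; $A$ is *regular* if $0<|\Delta_B|<\infty$ for every $\emptyset\ne B\subseteq A$. A *generalized Boolean dynamical system* $(\mathcal B,\mathcal L,\theta,\mathcal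 I_\alpha)$ has in addition ideals $\mathcal I_\alpha$ of $\mathcal B$ ($\alpha\in\mathcal L$) with $\mathcal R_\alpha:=\{A\in\mathcal B: A\subseteq\theta_\alpha(B)\text{ for some }B\in\mathcal B\}\subseteq\mathcal I_\alpha$. **Condition (L).** For a word $\beta=\beta_1\cdots\beta_n$ with $n\ge 1$ and $\emptyset\neq A\in\mathcal B$, the pair $(\beta,A)$ is a *cycle* if $\theta_\beta(B)=B$ for all $B\subseteq A$. It has *no exits* if for every $t\in\{1,\dots,n\}$ every $\emptyset\ne B\subseteq\theta_{\beta_{1,t}}(A)$ is regular with $\Delta_B=\{\beta_{t+1}\}$, where $\beta_{n+1}:=\beta_1$. The system $(\mathcal B,\mathcal L,\theta)$ satisfies *Condition (L)* if it has no cycle with no exits. **Partially defined topological graphs.** Such a graph $E=(E^0,E^1,d,r)$ consists of locally compact Hausdorff spaces $E^0,E^1$, a local homeomorphism $d:E^1\to E^0$ and a continuous map $r:\operatorname{dom}(r)\to E^0$ on an open set $\operatorname{dom}(r)\subseteq E^1$ such that extending $r$ by the value $\infty$ outside $\operatorname{dom}(r)$ gives a continuous map from $E^1$ to the one-point compactification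 of $E^0$ (with $\infty$ isolated if $E^0$ is compact). A *path* of length $n\ge1$ is a sequence $e=(e_1,\dots,e_n)$ in $E^1$ such that $e_{i+1}\in\operatorname{dom}(r)$ and $d(e_i)=r(e_{i+1})$ for $1\le i<n$. It is a *loop* with *base point* $v$ if $e_1\in\operatorname{dom}(r)$ and $r(e_1)=d(e_n)=v$; a loop is *without entrances* if $r^{-1}(r(e_k))=\{e_k\}$ for $k=1,\dots,n$. The graph $E$ is *topologically free* if the set of base points of loops without entrances has empty interior in $E^0$. **The associated graph.** For a generalized Boolean dynamical system $(\mathcal B,\mathcal L,\theta,\mathcal I_\alpha)$ the partially defined topological graph $E=E_{(\mathcal B,\mathcal L,\theta,\mathcal I_\alpha)}$ is given by $E^0=\widehat{\mathcal B}$; $E^1=\{e^\alpha_\eta:\alpha\in\mathcal L,\ \eta\in\widehat{\mathcal I_\alpha}\}$ with the topology generated by the sets $Z^1(\alpha,B)=\{e^\alpha_\eta: B\in\eta\}$ for $\alpha\in\mathcal L$, $B\in\mathcal I_\alpha$; $d(e^\alpha_\eta)=\{A\in\mathcal B: B\subseteq A\text{ for some }B\in\eta\}$; $\operatorname{dom}(r)=\{e^\alpha_\eta:\eta\cap\mathcal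 R_\alpha\neq\emptyset\}$; and $r(e^\alpha_\eta)=\{A\in\mathcal B:\theta_\alpha(A)\in\eta\}$. **Proposition.** Let $(\mathcal B,\mathcal L,\theta,\mathcal I_\alpha)$ be a generalized Boolean dynamical system. Then $(\mathcal B,\mathcal L,\theta)$ satisfies Condition (L) if and only if $E_{(\mathcal B,\mathcal L,\theta,\mathcal I_\alpha)}$ is topologically free. -/

import Mathlib

namespace BoolDyn

open Set Topology

universe u v

/-! ### Filters, ultrafilters and the Stone space of a Boolean algebra

A Boolean algebra here is a relatively complemented distributive lattice with a least element,
not necessarily unital, i.e. Mathlib's `GeneralizedBooleanAlgebra`. -/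

section Ultrafilters

variable {C : Type u} [GeneralizedBooleanAlgebra C]

/-- A filter of a Boolean algebra: non-empty, not containing the least element, closed under
intersections and upper closed. -/
structure IsFilter (F : Set C) : Prop where
  nonempty : F.Nonempty
  bot_notMem : ⊥ ∉ F
  inf_mem : ∀ {a b : C}, a ∈ F → b ∈ F → a ⊓ b ∈ F
  mem_of_le : ∀ {a b : C}, a ∈ F → a ≤ b → b ∈ F

variable (C) in
/-- The ultrafilters of a Boolean algebra, i.e. the maximal filters. -/
@[ext] structure Ultra where
  carrier : Set C
  maximal : Maximal IsFilter carrier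

instance : Membership C (Ultra C) := ⟨fun F a => a ∈ F.carrier⟩

/-- The set `Z(A)` of all ultrafilters containing `A`. -/
def Z (a : C) : Set (Ultra C) := {F | a ∈ F}

/-- The topology generated by the sets `Z(A)`. -/
instance : TopologicalSpace (Ultra C) := TopologicalSpace.generateFrom (range Z)

theorem Ultra.isFilter (F : Ultra C) : IsFilter F.carrier := F.maximal.prop

theorem Ultra.nonempty (F : Ultra C) : ∃ a, a ∈ F := F.isFilter.nonempty

theorem Ultra.bot_notMem (F : Ultra C) : ⊥ ∉ F := F.isFilter.bot_notMem

theorem Ultra.inf_mem (F : Ultra C) {a b : C} (ha : a ∈ F) (hb : b ∈ F) : a ⊓ b ∈ F :=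
  F.isFilter.inf_mem ha hb

theorem Ultra.mem_of_le (F : Ultra C) {a b : C} (ha : a ∈ F) (h : a ≤ b) : b ∈ F :=
  F.isFilter.mem_of_le ha h

theorem Ultra.ext_mem {F G : Ultra C} (h : ∀ a, a ∈ F ↔ a ∈ G) : F = G :=
  Ultra.ext (Set.ext h)

theorem Ultra.mem_or_sdiff_mem (F : Ultra C) {a : C} (ha : a ∈ F) (b : C) :
    b ∈ F ∨ a \ b ∈ F := by
  by_contra! hcon
  obtain ⟨hb, hab⟩ := hcon
  have key : ∀ y ∈ F, y ⊓ b ≠ ⊥ := by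
    intro y hy h0
    refine hab (F.mem_of_le (F.inf_mem ha hy) ?_)
    rw [le_sdiff]
    exact ⟨inf_le_left, (disjoint_iff.2 h0).mono_left inf_le_right⟩
  have hG : IsFilter {x : C | ∃ y ∈ F, y ⊓ b ≤ x} := by
    refine ⟨⟨a, a, ha, inf_le_left⟩, ?_, ?_, ?_⟩
    · rintro ⟨y, hy, hyb⟩
      exact key y hy (le_bot_iff.1 hyb)
    · rintro x x' ⟨y, hy, h⟩ ⟨y', hy', h'⟩
      refine ⟨y ⊓ y', F.inf_mem hy hy', le_inf ?_ ?_⟩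
      · exact (inf_le_inf_right b inf_le_left).trans h
      · exact (inf_le_inf_right b inf_le_right).trans h'
    · rintro x x' ⟨y, hy, h⟩ hx
      exact ⟨y, hy, h.trans hx⟩
  have hle : F.carrier ≤ {x : C | ∃ y ∈ F, y ⊓ b ≤ x} := fun x hx => ⟨x, hx, inf_le_left⟩
  exact hb (F.maximal.2 hG hle ⟨a, ha, inf_le_right⟩)

theorem IsFilter.maximal_of {F : Set C} (hF : IsFilter F)
    (h : ∀ a ∈ F, ∀ b, b ∈ F ∨ a \ b ∈ F) : Maximal IsFilter F := by
  refine ⟨hF, fun G hG hFG b hb => ?_⟩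
  obtain ⟨a, ha⟩ := hF.nonempty
  rcases h a ha b with h1 | h1
  · exact h1
  · exact absurd (by simpa using hG.inf_mem hb (hFG h1)) hG.bot_notMem

theorem IsFilter.exists_ultra {F : Set C} (hF : IsFilter F) : ∃ G : Ultra C, F ⊆ G.carrier := by
  obtain ⟨M, hFM, hM⟩ := zorn_subset_nonempty {S : Set C | IsFilter S} (by
    intro c hc hchain hne
    refine ⟨⋃₀ c, ⟨?_, ?_, ?_, ?_⟩, fun s hs => subset_sUnion_of_mem hs⟩
    · obtain ⟨s, hs⟩ := hne
      obtain ⟨x, hx⟩ := (hc hs).nonempty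
      exact ⟨x, s, hs, hx⟩
    · rintro ⟨s, hs, h⟩
      exact (hc hs).bot_notMem h
    · rintro a b ⟨s, hs, ha⟩ ⟨t, ht, hb⟩
      rcases hchain.total hs ht with h | h
      · exact ⟨t, ht, (hc ht).inf_mem (h ha) hb⟩
      · exact ⟨s, hs, (hc hs).inf_mem ha (h hb)⟩
    · rintro a b ⟨s, hs, ha⟩ hab
      exact ⟨s, hs, (hc hs).mem_of_le ha hab⟩) F hF
  exact ⟨⟨M, hM⟩, hFM⟩

theorem isOpen_Z (a : C) : IsOpen (Z a) := TopologicalSpace.isOpen_generateFrom_of_mem ⟨a, rfl⟩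

theorem isTopologicalBasis_Z :
    TopologicalSpace.IsTopologicalBasis (range (Z : C → Set (Ultra C))) where
  exists_subset_inter := by
    rintro _ ⟨a, rfl⟩ _ ⟨b, rfl⟩ F ⟨ha, hb⟩
    exact ⟨_, ⟨a ⊓ b, rfl⟩, F.inf_mem ha hb,
      fun G hG => ⟨G.mem_of_le hG inf_le_left, G.mem_of_le hG inf_le_right⟩⟩
  sUnion_eq := by
    refine eq_univ_of_forall fun F => ?_
    obtain ⟨a, ha⟩ := F.nonempty
    exact ⟨_, ⟨a, rfl⟩, ha⟩
  eq_generateFrom := rfl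

theorem isCompact_Z (a : C) : IsCompact (Z a) := by
  classical
  refine isCompact_generateFrom (S := range (Z : C → Set (Ultra C))) rfl fun P hP hcov => ?_
  by_contra! hcon
  have key : ∀ s : Finset C, (∀ b ∈ s, Z b ∈ P) → a \ s.sup id ≠ ⊥ := by
    intro s hs h0
    refine hcon (Z '' (s : Set C)) ?_ (s.finite_toSet.image _) ?_
    · rintro _ ⟨b, hb, rfl⟩
      exact hs b hb
    · intro F (hF : a ∈ F)
      by_contra hno
      have hmem : ∀ t : Finset C, t ⊆ s → a \ t.sup id ∈ F := by
        intro t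
        induction t using Finset.induction_on with
        | empty => intro _; simpa using hF
        | insert b t _ ih =>
          intro hsub
          have h1 := ih fun x hx => hsub (Finset.mem_insert_of_mem hx)
          rcases F.mem_or_sdiff_mem h1 b with h2 | h2
          · exact absurd ⟨Z b, ⟨b, hsub (Finset.mem_insert_self b t), rfl⟩, h2⟩ hno
          · have : a \ (insert b t).sup id = (a \ t.sup id) \ b := by
              rw [Finset.sup_insert, sdiff_sdiff_left, sup_comm]; rfl
            rwa [this]
      have := hmem s subset_rfl
      rw [h0] at this
      exact F.bot_notMem this
  have hfil : IsFilter {x : C | ∃ s : Finset C, (∀ b ∈ s, Z b ∈ P) ∧ a \ s.sup id ≤ x} := by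
    refine ⟨⟨a, ∅, by simp, by simp⟩, ?_, ?_, ?_⟩
    · rintro ⟨s, hs, h⟩
      exact key s hs (le_bot_iff.1 h)
    · rintro x y ⟨s, hs, hx⟩ ⟨t, ht, hy⟩
      refine ⟨s ∪ t, fun b hb => (Finset.mem_union.1 hb).elim (hs b) (ht b), le_inf ?_ ?_⟩
      · exact (sdiff_le_sdiff_left (Finset.sup_mono Finset.subset_union_left)).trans hx
      · exact (sdiff_le_sdiff_left (Finset.sup_mono Finset.subset_union_right)).trans hy
    · rintro x y ⟨s, hs, hx⟩ hxy
      exact ⟨s, hs, hx.trans hxy⟩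
  obtain ⟨G, hG⟩ := hfil.exists_ultra
  have haG : a ∈ G := hG ⟨∅, by simp, by simp⟩
  obtain ⟨U, hU, hGU⟩ := hcov (show G ∈ Z a from haG)
  obtain ⟨b, rfl⟩ := hP hU
  have h1 : a \ b ∈ G := hG ⟨{b}, by simpa using hU, by simp⟩
  refine G.bot_notMem (G.mem_of_le (G.inf_mem hGU h1) ?_)
  simp

instance : T2Space (Ultra C) := by
  refine ⟨fun F G hne => ?_⟩
  have key : ∀ F G : Ultra C, ∀ a ∈ F, a ∉ G →
      ∃ U V : Set (Ultra C), IsOpen U ∧ IsOpen V ∧ F ∈ U ∧ G ∈ V ∧ Disjoint U V := by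
    intro F G a ha ha'
    obtain ⟨b, hb⟩ := G.nonempty
    refine ⟨Z a, Z (b \ a), isOpen_Z _, isOpen_Z _, ha,
      (G.mem_or_sdiff_mem hb a).resolve_left ha', ?_⟩
    rw [Set.disjoint_left]
    intro H h1 h2
    exact H.bot_notMem (by simpa using H.inf_mem h1 h2)
  by_cases h : ∀ a ∈ F, a ∈ G
  · have : ∃ a ∈ G, a ∉ F := by
      by_contra! h'
      exact hne (Ultra.ext_mem fun a => ⟨h a, h' a⟩)
    obtain ⟨a, ha, ha'⟩ := this
    obtain ⟨U, V, h1, h2, h3, h4, h5⟩ := key G F a ha ha'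
    exact ⟨V, U, h2, h1, h4, h3, h5.symm⟩
  · push Not at h
    obtain ⟨a, ha, ha'⟩ := h
    exact key F G a ha ha'

instance : LocallyCompactSpace (Ultra C) := by
  have : WeaklyLocallyCompactSpace (Ultra C) := by
    refine ⟨fun F => ?_⟩
    obtain ⟨a, ha⟩ := F.nonempty
    exact ⟨Z a, isCompact_Z a, (isOpen_Z a).mem_nhds ha⟩
  infer_instance

end Ultrafilters

/-- An ideal of a Boolean algebra is a Boolean algebra with the inherited operations. -/
instance idealBooleanAlgebra {B : Type u} [GeneralizedBooleanAlgebra B] (I : Order.Ideal B) :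
    GeneralizedBooleanAlgebra I where
  __ := (inferInstance : PartialOrder I)
  sup a b := ⟨a.1 ⊔ b.1, I.sup_mem a.2 b.2⟩
  inf a b := ⟨a.1 ⊓ b.1, I.lower inf_le_left a.2⟩
  sdiff a b := ⟨a.1 \ b.1, I.lower sdiff_le a.2⟩
  bot := ⟨⊥, I.bot_mem⟩
  le_sup_left a b := Subtype.coe_le_coe.1 (le_sup_left (a := a.1) (b := b.1))
  le_sup_right a b := Subtype.coe_le_coe.1 (le_sup_right (a := a.1) (b := b.1))
  sup_le _ _ _ h1 h2 :=
    Subtype.coe_le_coe.1 (sup_le (Subtype.coe_le_coe.2 h1) (Subtype.coe_le_coe.2 h2))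
  inf_le_left a b := Subtype.coe_le_coe.1 (inf_le_left (a := a.1) (b := b.1))
  inf_le_right a b := Subtype.coe_le_coe.1 (inf_le_right (a := a.1) (b := b.1))
  le_inf _ _ _ h1 h2 :=
    Subtype.coe_le_coe.1 (le_inf (Subtype.coe_le_coe.2 h1) (Subtype.coe_le_coe.2 h2))
  le_sup_inf a b c := Subtype.coe_le_coe.1 (le_sup_inf (x := a.1) (y := b.1) (z := c.1))
  sup_inf_sdiff a b := Subtype.ext (sup_inf_sdiff a.1 b.1)
  inf_inf_sdiff a b := Subtype.ext (inf_inf_sdiff a.1 b.1)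

/-! ### Boolean dynamical systems and Condition (L) -/

/-- A Boolean dynamical system: a family `θ` of actions on the Boolean algebra `B`, indexed by
the set `L` of labels. -/
structure BooleanDynamicalSystem (B : Type u) (L : Type v) [GeneralizedBooleanAlgebra B] where
  θ : L → B → B
  map_inf : ∀ α a b, θ α (a ⊓ b) = θ α a ⊓ θ α b
  map_sup : ∀ α a b, θ α (a ⊔ b) = θ α a ⊔ θ α b
  map_sdiff : ∀ α a b, θ α (a \ b) = θ α a \ θ α b
  map_bot : ∀ α, θ α ⊥ = ⊥

namespace BooleanDynamicalSystem

variable {B : Type u} {L : Type v} [GeneralizedBooleanAlgebra B]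
  (S : BooleanDynamicalSystem B L)

/-- The action `θ_β = θ_{β_n} ∘ ⋯ ∘ θ_{β_1}` of a word `β = β_1 ⋯ β_n`; the empty word acts
as the identity. -/
def act (β : List L) (A : B) : B := β.foldl (fun A α => S.θ α A) A

/-- `Δ_A`, the set of labels `α` with `θ_α(A) ≠ ∅`. -/
def Δ (A : B) : Set L := {α | S.θ α A ≠ ⊥}

/-- `A` is regular if `0 < |Δ_B| < ∞` for every non-empty `B ⊆ A`. -/
def IsRegular (A : B) : Prop := ∀ B', B' ≠ ⊥ → B' ≤ A → (S.Δ B').Nonempty ∧ (S.Δ B').Finite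

/-- `(β, A)` is a cycle: `β` and `A` are non-empty and `θ_β(B) = B` for all `B ⊆ A`. -/
def IsCycle (β : List L) (A : B) : Prop :=
  β ≠ [] ∧ A ≠ ⊥ ∧ ∀ B' ≤ A, B' = S.act β B'

/-- `(β, A)` has no exits: for `t ∈ {1, …, n}` every non-empty `B ⊆ θ_{β_1 ⋯ β_t}(A)` is regular
with `Δ_B = {β_{t+1}}`, where `β_{n+1} := β_1`. The letter `β_{t+1}` is the entry at position
`t % n` of the list `β`, whose entries are numbered from `0`. -/
def HasNoExits (β : List L) (hβ : β ≠ []) (A : B) : Prop :=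
  ∀ t, 1 ≤ t → t ≤ β.length → ∀ B', B' ≠ ⊥ → B' ≤ S.act (β.take t) A →
    S.IsRegular B' ∧
      S.Δ B' = {β[t % β.length]'(Nat.mod_lt _ (List.length_pos_of_ne_nil hβ))}

/-- Condition (L): there is no cycle with no exits. -/
def ConditionL : Prop :=
  ¬ ∃ (β : List L) (hβ : β ≠ []) (A : B), S.IsCycle β A ∧ S.HasNoExits β hβ A

/-- `R_α`, the set of all `A` contained in `θ_α(B)` for some `B`. -/
def R (α : L) : Set B := {A | ∃ B', A ≤ S.θ α B'}

theorem θ_mono (α : L) {a b : B} (h : a ≤ b) : S.θ α a ≤ S.θ α b := by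
  rw [← inf_eq_left] at h ⊢
  rw [← S.map_inf, h]

end BooleanDynamicalSystem

/-- A generalized Boolean dynamical system: a Boolean dynamical system with ideals `I_α` of `B`
such that `R_α ⊆ I_α`. -/
structure GeneralizedBooleanDynamicalSystem (B : Type u) (L : Type v)
    [GeneralizedBooleanAlgebra B] extends BooleanDynamicalSystem B L where
  I : L → Order.Ideal B
  R_subset_I : ∀ α A, A ∈ toBooleanDynamicalSystem.R α → A ∈ I α

/-! ### Partially defined topological graphs -/

open Classical in
/-- The extension of a partially defined map by the value `∞` in the one-point
compactification. -/
noncomputable def extendByInfty {V : Type u} {E : Type v} (dom : Set E) (r : dom → V) (e : E) :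
    OnePoint V :=
  if h : e ∈ dom then (r ⟨e, h⟩ : OnePoint V) else OnePoint.infty

/-- A partially defined topological graph with vertex space `V` and edge space `E`. -/
structure PartialTopologicalGraph (V : Type u) (E : Type v) [TopologicalSpace V]
    [TopologicalSpace E] where
  locallyCompact_vertices : LocallyCompactSpace V
  t2_vertices : T2Space V
  locallyCompact_edges : LocallyCompactSpace E
  t2_edges : T2Space E
  d : E → V
  isLocalHomeomorph_d : IsLocalHomeomorph d
  dom : Set E
  isOpen_dom : IsOpen dom
  r : dom → V
  continuous_r : Continuous r
  continuous_extend_r : Continuous (extendByInfty dom r)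

namespace PartialTopologicalGraph

variable {V : Type u} {E : Type v} [TopologicalSpace V] [TopologicalSpace E]
  (G : PartialTopologicalGraph V E)

/-- `e_1 ⋯ e_{n+1}` is a path of length `n + 1`: one has `d(e_i) = r(e_{i+1})` for `1 ≤ i ≤ n`,
in particular `r` is defined at `e_{i+1}`. -/
def IsPath {n : ℕ} (e : Fin (n + 1) → E) : Prop :=
  ∀ i : Fin n, ∃ h : e i.succ ∈ G.dom, G.d (e i.castSucc) = G.r ⟨e i.succ, h⟩

/-- The path `e` is a loop with base point `v`: its range and its domain are both `v`. -/
def IsLoopAt {n : ℕ} (e : Fin (n + 1) → E) (v : V) : Prop :=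
  G.IsPath e ∧ (∃ h : e 0 ∈ G.dom, G.r ⟨e 0, h⟩ = v) ∧ G.d (e (Fin.last n)) = v

/-- The path `e` is without entrances: `r⁻¹(r(e_k)) = {e_k}` for all `k`. -/
def WithoutEntrances {n : ℕ} (e : Fin (n + 1) → E) : Prop :=
  ∀ k, ∃ h : e k ∈ G.dom, Subtype.val '' (G.r ⁻¹' {G.r ⟨e k, h⟩}) = {e k}

/-- The set of base points of loops without entrances. -/
def basePoints : Set V :=
  {v | ∃ (n : ℕ) (e : Fin (n + 1) → E), G.IsLoopAt e v ∧ G.WithoutEntrances e}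

/-- The graph is topologically free if the set of base points of loops without entrances has
empty interior. -/
def TopologicallyFree : Prop := interior G.basePoints = ∅

end PartialTopologicalGraph

/-! ### The graph of a generalized Boolean dynamical system -/

namespace GeneralizedBooleanDynamicalSystem

variable {B : Type u} {L : Type v} [GeneralizedBooleanAlgebra B]
  (S : GeneralizedBooleanDynamicalSystem B L)

/-- The edges `e^α_η`, where `α` is a label and `η` is an ultrafilter of `I_α`. -/
structure Edge where
  label : L
  ultra : Ultra (S.I label)

/-- The set `Z¹(α, A)` of the edges `e^α_η` with `A ∈ η`, for `A ∈ I_α`. -/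
def Z1 (α : L) (A : S.I α) : Set S.Edge := Edge.mk α '' Z A

/-- The topology generated by the sets `Z¹(α, A)`. -/
instance : TopologicalSpace S.Edge :=
  TopologicalSpace.generateFrom {U | ∃ (α : L) (A : S.I α), U = S.Z1 α A}

/-- The ultrafilter `h_{[α]∅}(η) = {A ∈ B : A' ⊆ A for some A' ∈ η}` of `B`. -/
def extend {α : L} (η : Ultra (S.I α)) : Ultra B where
  carrier := {A | ∃ A' ∈ η, (A' : B) ≤ A}
  maximal := by
    refine IsFilter.maximal_of ⟨?_, ?_, ?_, ?_⟩ ?_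
    · obtain ⟨a, ha⟩ := η.nonempty
      exact ⟨a, a, ha, le_rfl⟩
    · rintro ⟨a, ha, h⟩
      have : a = ⊥ := Subtype.ext (le_bot_iff.1 h)
      exact η.bot_notMem (this ▸ ha)
    · rintro a b ⟨a', ha', h⟩ ⟨b', hb', h'⟩
      exact ⟨a' ⊓ b', η.inf_mem ha' hb', inf_le_inf h h'⟩
    · rintro a b ⟨a', ha', h⟩ hab
      exact ⟨a', ha', h.trans hab⟩
    · rintro a ⟨a', ha', h⟩ b
      rcases η.mem_or_sdiff_mem ha' ⟨a'.1 ⊓ b, (S.I α).lower inf_le_left a'.2⟩ with h1 | h1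
      · exact Or.inl ⟨_, h1, inf_le_right⟩
      · refine Or.inr ⟨_, h1, ?_⟩
        change a'.1 \ (a'.1 ⊓ b) ≤ a \ b
        rw [sdiff_inf_self_left]
        exact sdiff_le_sdiff_right h

/-- The domain of the range map: the edges `e^α_η` with `η ∩ R_α ≠ ∅`. -/
def dom : Set S.Edge := {e | ∃ A ∈ e.ultra, (A : B) ∈ S.R e.label}

/-- `θ_α(A)` as an element of `I_α`. -/
def θI (α : L) (A : B) : S.I α := ⟨S.θ α A, S.R_subset_I α _ ⟨A, le_rfl⟩⟩

/-- The ultrafilter `f_{∅[α]}(η) = {A ∈ B : θ_α(A) ∈ η}` of `B`, for `e^α_η` in the domain of the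
range map. -/
def pullback (e : S.dom) : Ultra B where
  carrier := {A | S.θI e.1.label A ∈ e.1.ultra}
  maximal := by
    refine IsFilter.maximal_of ⟨?_, ?_, ?_, ?_⟩ ?_
    · obtain ⟨A, hA, A', h⟩ := e.2
      exact ⟨A', e.1.ultra.mem_of_le hA h⟩
    · intro h
      have h0 : S.θI e.1.label ⊥ = ⊥ := Subtype.ext (S.map_bot _)
      exact e.1.ultra.bot_notMem (h0 ▸ h)
    · intro a b ha hb
      have h0 : S.θI e.1.label (a ⊓ b) = S.θI e.1.label a ⊓ S.θI e.1.label b :=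
        Subtype.ext (S.map_inf _ _ _)
      exact (congrArg (· ∈ e.1.ultra) h0).mpr (e.1.ultra.inf_mem ha hb)
    · intro a b ha hab
      exact e.1.ultra.mem_of_le ha (S.θ_mono _ hab)
    · intro a ha b
      have h0 : S.θI e.1.label (a \ b) = S.θI e.1.label a \ S.θI e.1.label b :=
        Subtype.ext (S.map_sdiff _ _ _)
      rcases e.1.ultra.mem_or_sdiff_mem ha (S.θI e.1.label b) with h | h
      · exact Or.inl h
      · exact Or.inr ((congrArg (· ∈ e.1.ultra) h0).mpr h)

theorem mk_mem_Z1 {α : L} {A : S.I α} {η : Ultra (S.I α)} :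
    (⟨α, η⟩ : S.Edge) ∈ S.Z1 α A ↔ A ∈ η := by
  constructor
  · rintro ⟨ξ, hξ, h⟩
    cases h
    exact hξ
  · exact fun h => ⟨η, h, rfl⟩

theorem isOpen_Z1 (α : L) (A : S.I α) : IsOpen (S.Z1 α A) :=
  TopologicalSpace.isOpen_generateFrom_of_mem ⟨α, A, rfl⟩

theorem isTopologicalBasis_Z1 :
    TopologicalSpace.IsTopologicalBasis {U | ∃ (α : L) (A : S.I α), U = S.Z1 α A} where
  exists_subset_inter := by
    rintro _ ⟨α, A, rfl⟩ _ ⟨α', A', rfl⟩ _ ⟨⟨η, hη, rfl⟩, ⟨ξ, hξ, h⟩⟩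
    cases h
    refine ⟨_, ⟨α, A ⊓ A', rfl⟩, S.mk_mem_Z1.2 (η.inf_mem hη hξ), ?_⟩
    rintro _ ⟨ζ, hζ, rfl⟩
    exact ⟨S.mk_mem_Z1.2 (ζ.mem_of_le hζ inf_le_left),
      S.mk_mem_Z1.2 (ζ.mem_of_le hζ inf_le_right)⟩
  sUnion_eq := by
    refine eq_univ_of_forall fun ⟨α, η⟩ => ?_
    obtain ⟨a, ha⟩ := η.nonempty
    exact ⟨_, ⟨α, a, rfl⟩, S.mk_mem_Z1.2 ha⟩
  eq_generateFrom := rfl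

theorem continuous_mk (α : L) : Continuous (Edge.mk (S := S) α) := by
  refine S.isTopologicalBasis_Z1.continuous_iff.2 ?_
  rintro _ ⟨α', A, rfl⟩
  by_cases h : α' = α
  · subst h
    have : Edge.mk (S := S) α' ⁻¹' S.Z1 α' A = Z A := by
      ext η
      exact S.mk_mem_Z1
    rw [this]
    exact isOpen_Z A
  · have : Edge.mk (S := S) α ⁻¹' S.Z1 α' A = ∅ := by
      ext η
      simp only [mem_preimage, mem_empty_iff_false, iff_false]
      rintro ⟨ξ, _, h'⟩
      exact h (congrArg Edge.label h')
    rw [this]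
    exact isOpen_empty

theorem isOpenMap_mk (α : L) : IsOpenMap (Edge.mk (S := S) α) := by
  refine isTopologicalBasis_Z.isOpenMap_iff.2 ?_
  rintro _ ⟨A, rfl⟩
  exact S.isOpen_Z1 α A

instance : T2Space S.Edge := by
  refine ⟨fun ⟨α, η⟩ ⟨α', η'⟩ hne => ?_⟩
  by_cases h : α = α'
  · subst h
    have hne' : η ≠ η' := fun h => hne (h ▸ rfl)
    obtain ⟨U, V, hU, hV, h1, h2, h3⟩ := t2_separation hne'
    refine ⟨_, _, S.isOpenMap_mk α U hU, S.isOpenMap_mk α V hV, ⟨η, h1, rfl⟩, ⟨η', h2, rfl⟩, ?_⟩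
    rw [Set.disjoint_left] at h3 ⊢
    rintro _ ⟨ξ, hξ, rfl⟩ ⟨ζ, hζ, hh⟩
    cases hh
    exact h3 hξ hζ
  · refine ⟨_, _, S.isOpenMap_mk α univ isOpen_univ, S.isOpenMap_mk α' univ isOpen_univ,
      ⟨η, trivial, rfl⟩, ⟨η', trivial, rfl⟩, ?_⟩
    rw [Set.disjoint_left]
    rintro _ ⟨ξ, _, rfl⟩ ⟨ζ, _, hh⟩
    exact h (congrArg Edge.label hh).symm

instance : LocallyCompactSpace S.Edge := by
  have : WeaklyLocallyCompactSpace S.Edge := by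
    refine ⟨fun ⟨α, η⟩ => ?_⟩
    obtain ⟨a, ha⟩ := η.nonempty
    exact ⟨S.Z1 α a, (isCompact_Z a).image (S.continuous_mk α),
      (S.isOpen_Z1 α a).mem_nhds (S.mk_mem_Z1.2 ha)⟩
  infer_instance

theorem mem_extend_iff {α : L} (η : Ultra (S.I α)) (A : S.I α) :
    (A : B) ∈ S.extend η ↔ A ∈ η :=
  ⟨fun ⟨_, h, h'⟩ => η.mem_of_le h h', fun h => ⟨A, h, le_rfl⟩⟩

theorem extend_injective {α : L} : Function.Injective (S.extend (α := α)) := by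
  intro η ξ h
  refine Ultra.ext_mem fun a => ?_
  rw [← S.mem_extend_iff, ← S.mem_extend_iff, h]

/-- An ultrafilter `F` of `B` restricts to the ultrafilter `F ∩ I_α` of `I_α` as soon as this
intersection is non-empty. -/
theorem exists_extend_eq {α : L} (F : Ultra B) (A : S.I α) (hA : (A : B) ∈ F) :
    ∃ η : Ultra (S.I α), A ∈ η ∧ S.extend η = F := by
  have hmax : Maximal IsFilter {a : S.I α | (a : B) ∈ F} := by
    refine IsFilter.maximal_of ⟨⟨A, hA⟩, F.bot_notMem, fun ha hb => F.inf_mem ha hb,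
      fun ha hab => F.mem_of_le ha hab⟩ fun a ha b => F.mem_or_sdiff_mem ha b
  refine ⟨⟨_, hmax⟩, hA, Ultra.ext_mem fun a => ⟨?_, fun ha => ?_⟩⟩
  · rintro ⟨a', ha', h⟩
    exact F.mem_of_le ha' h
  · refine ⟨⟨A.1 ⊓ a, (S.I α).lower inf_le_left A.2⟩, F.inf_mem hA ha, inf_le_right⟩

theorem isLocalHomeomorph_extend :
    IsLocalHomeomorph (fun e : S.Edge => S.extend e.ultra) := by
  have hc : Continuous (fun e : S.Edge => S.extend e.ultra) := by
    refine isTopologicalBasis_Z.continuous_iff.2 ?_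
    rintro _ ⟨A, rfl⟩
    rw [isOpen_iff_mem_nhds]
    rintro ⟨α, η⟩ ⟨A', hA', h⟩
    refine Filter.mem_of_superset ((S.isOpen_Z1 α A').mem_nhds (S.mk_mem_Z1.2 hA')) ?_
    rintro _ ⟨ξ, hξ, rfl⟩
    exact ⟨A', hξ, h⟩
  have ho : IsOpenMap (fun e : S.Edge => S.extend e.ultra) := by
    refine S.isTopologicalBasis_Z1.isOpenMap_iff.2 ?_
    rintro _ ⟨α, A, rfl⟩
    have : (fun e : S.Edge => S.extend e.ultra) '' S.Z1 α A = Z (A : B) := by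
      ext F
      constructor
      · rintro ⟨_, ⟨ξ, hξ, rfl⟩, rfl⟩
        exact (S.mem_extend_iff ξ A).2 hξ
      · intro hF
        obtain ⟨η, hη, h⟩ := S.exists_extend_eq F A hF
        exact ⟨⟨α, η⟩, S.mk_mem_Z1.2 hη, h⟩
    rw [this]
    exact isOpen_Z _
  refine isLocalHomeomorph_iff_isOpenEmbedding_restrict.2 fun ⟨α, η⟩ => ?_
  have hU : IsOpen (range (Edge.mk (S := S) α)) := (S.isOpenMap_mk α).isOpen_range
  refine ⟨range (Edge.mk α), hU.mem_nhds ⟨η, rfl⟩, ?_⟩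
  refine Topology.IsOpenEmbedding.of_continuous_injective_isOpenMap
    (hc.comp continuous_subtype_val) ?_ (ho.comp hU.isOpenMap_subtype_val)
  rintro ⟨_, ⟨ξ, rfl⟩⟩ ⟨_, ⟨ζ, rfl⟩⟩ h
  have : ξ = ζ := S.extend_injective h
  subst this
  rfl

theorem isOpen_dom : IsOpen S.dom := by
  rw [isOpen_iff_mem_nhds]
  rintro ⟨α, η⟩ ⟨A, hA, h⟩
  refine Filter.mem_of_superset ((S.isOpen_Z1 α A).mem_nhds (S.mk_mem_Z1.2 hA)) ?_
  rintro _ ⟨ξ, hξ, rfl⟩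
  exact ⟨A, hξ, h⟩

theorem isClopen_rangePreimage (A : B) : IsClopen {e : S.Edge | S.θI e.label A ∈ e.ultra} := by
  constructor
  · rw [← isOpen_compl_iff, isOpen_iff_mem_nhds]
    rintro ⟨α, η⟩ h
    obtain ⟨a, ha⟩ := η.nonempty
    have h1 := (η.mem_or_sdiff_mem ha (S.θI α A)).resolve_left h
    refine Filter.mem_of_superset ((S.isOpen_Z1 α _).mem_nhds (S.mk_mem_Z1.2 h1)) ?_
    rintro _ ⟨ξ, hξ, rfl⟩ (h2 : S.θI α A ∈ ξ)
    exact ξ.bot_notMem (by simpa using ξ.inf_mem h2 hξ)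
  · rw [isOpen_iff_mem_nhds]
    rintro ⟨α, η⟩ h
    refine Filter.mem_of_superset ((S.isOpen_Z1 α _).mem_nhds (S.mk_mem_Z1.2 h)) ?_
    rintro _ ⟨ξ, hξ, rfl⟩
    exact hξ

theorem continuous_pullback : Continuous S.pullback := by
  refine isTopologicalBasis_Z.continuous_iff.2 ?_
  rintro _ ⟨A, rfl⟩
  exact (S.isClopen_rangePreimage A).isOpen.preimage continuous_subtype_val

theorem continuous_extendByInfty_pullback : Continuous (extendByInfty S.dom S.pullback) := by
  rw [continuous_iff_continuousAt]
  intro e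
  by_cases he : e ∈ S.dom
  · have hon : ContinuousOn (extendByInfty S.dom S.pullback) S.dom := by
      rw [continuousOn_iff_continuous_domRestrict]
      convert OnePoint.continuous_coe.comp S.continuous_pullback using 1
      funext x
      exact dif_pos x.2
    exact hon.continuousAt (S.isOpen_dom.mem_nhds he)
  · have h0 : extendByInfty S.dom S.pullback e = OnePoint.infty := dif_neg he
    rw [ContinuousAt, h0, OnePoint.hasBasis_nhds_infty.tendsto_right_iff]
    rintro K ⟨-, hK⟩
    have hcover : ∃ A : B, K ⊆ Z A := by
      refine hK.induction_on (p := fun K => ∃ A : B, K ⊆ Z A) ⟨⊥, empty_subset _⟩ ?_ ?_ ?_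
      · rintro s t hst ⟨A, hA⟩
        exact ⟨A, hst.trans hA⟩
      · rintro s t ⟨A, hA⟩ ⟨A', hA'⟩
        refine ⟨A ⊔ A', union_subset (fun F hF => F.mem_of_le (hA hF) le_sup_left)
          (fun F hF => F.mem_of_le (hA' hF) le_sup_right)⟩
      · intro F _
        obtain ⟨a, ha⟩ := F.nonempty
        exact ⟨Z a, mem_nhdsWithin_of_mem_nhds ((isOpen_Z a).mem_nhds ha), a, subset_rfl⟩
    obtain ⟨A, hKA⟩ := hcover
    have he' : e ∈ {e : S.Edge | S.θI e.label A ∈ e.ultra}ᶜ := fun h => he ⟨_, h, A, le_rfl⟩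
    filter_upwards [(S.isClopen_rangePreimage A).compl.isOpen.mem_nhds he'] with x hx
    by_cases hxd : x ∈ S.dom
    · left
      refine ⟨S.pullback ⟨x, hxd⟩, fun hxK => hx (hKA hxK), ?_⟩
      unfold extendByInfty
      rw [dif_pos hxd]
    · right
      exact dif_neg hxd

/-- The partially defined topological graph of a generalized Boolean dynamical system: the vertices
are the ultrafilters of `B`, the edges are the `e^α_η`, with `d(e^α_η) = h_{[α]∅}(η)` and
`r(e^α_η) = f_{∅[α]}(η)`. -/
def graph : PartialTopologicalGraph (Ultra B) S.Edge where
  locallyCompact_vertices := inferInstance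
  t2_vertices := inferInstance
  locallyCompact_edges := inferInstance
  t2_edges := inferInstance
  d e := S.extend e.ultra
  isLocalHomeomorph_d := S.isLocalHomeomorph_extend
  dom := S.dom
  isOpen_dom := S.isOpen_dom
  r := S.pullback
  continuous_r := S.continuous_pullback
  continuous_extend_r := S.continuous_extendByInfty_pullback

end GeneralizedBooleanDynamicalSystem

end BoolDyn

namespace BoolDyn

open Set Topology

/-! ### Separation of elements by ultrafilters. -/

section Ultrafilters

variable {C : Type*} [GeneralizedBooleanAlgebra C]

/-! An edge with range `x`, domain `y` and label `α` exists exactly when `x` is the inverse image of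
`y` under `θ_α`, and it is determined by `α` and `y`. So paths on which `r` is defined throughout
are encoded by `Pull`, and the ideals `I_α` play no further role. A loop without entrances is a
periodic orbit in which each vertex is the range of exactly one edge; following that edge is the
partial dynamics `succ`, and the base points form the union of the sets `loopPoints n` over `n > 0`
(`basePoints_graph`). It remains to show that this union has empty interior iff Condition (L) holds
(`conditionL_iff`).

If `(β, A)` is a cycle with no exits, the maps `θ` act bijectively between the elements below `A`
and those below its successive images (`HasNoExits.act_act_drop`), and only one label acts
non-trivially at each stage. Hence all of `Z A` consists of base points.

Conversely, let `Z A` consist of base points. Their periods and words may vary with the point. The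
points of a given period are closed in `Z A` (`isClosed_loopPoints_inter_Z`), so Baire's theorem
yields a smaller `Z A'` with a common period. Pulling back along the word of one loop then makes the
word common as well (`exists_pull_self`), and this word is a cycle with no exits. -/

theorem Ultra.eq_of_forall_mem {x y : Ultra C} (h : ∀ a ∈ x, a ∈ y) : x = y :=
  Ultra.ext (Set.Subset.antisymm h (x.maximal.2 y.isFilter h))

theorem exists_ultra_mem {a : C} (ha : a ≠ ⊥) : ∃ x : Ultra C, a ∈ x := by
  have hF : IsFilter (Set.Ici a) :=
    ⟨⟨a, le_rfl⟩, fun h => ha (le_bot_iff.1 h), fun h h' => le_inf h h', fun h h' => h.trans h'⟩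
  obtain ⟨x, hx⟩ := hF.exists_ultra
  exact ⟨x, hx le_rfl⟩

theorem Ultra.ne_bot_of_mem {x : Ultra C} {a : C} (ha : a ∈ x) : a ≠ ⊥ := by
  rintro rfl
  exact x.bot_notMem ha

theorem Ultra.sdiff_notMem {x : Ultra C} {a b : C} (hb : b ∈ x) : a \ b ∉ x := fun h =>
  x.bot_notMem (by simpa using x.inf_mem hb h)

theorem le_of_forall_ultra {a b : C} (h : ∀ x : Ultra C, a ∈ x → b ∈ x) : a ≤ b := by
  rw [← sdiff_eq_bot_iff]
  by_contra hne
  obtain ⟨x, hx⟩ := exists_ultra_mem hne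
  exact Ultra.sdiff_notMem (h x (x.mem_of_le hx sdiff_le)) hx

theorem isClosed_Z (a : C) : IsClosed (Z a) := (isCompact_Z a).isClosed

end Ultrafilters

/-! ### Words acting on elements, and inverse images of ultrafilters. -/

namespace BooleanDynamicalSystem

variable {B : Type*} {L : Type*} [GeneralizedBooleanAlgebra B] (S : BooleanDynamicalSystem B L)

@[simp] theorem act_nil (a : B) : S.act [] a = a := rfl

@[simp] theorem act_cons (α : L) (β : List L) (a : B) :
    S.act (α :: β) a = S.act β (S.θ α a) := rfl

theorem act_append (β γ : List L) (a : B) : S.act (β ++ γ) a = S.act γ (S.act β a) := by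
  simp [act]

theorem act_inf (β : List L) (a b : B) : S.act β (a ⊓ b) = S.act β a ⊓ S.act β b := by
  induction β generalizing a b with
  | nil => rfl
  | cons α β ih => simp [S.map_inf, ih]

theorem act_sdiff (β : List L) (a b : B) : S.act β (a \ b) = S.act β a \ S.act β b := by
  induction β generalizing a b with
  | nil => rfl
  | cons α β ih => simp [S.map_sdiff, ih]

theorem act_bot (β : List L) : S.act β ⊥ = ⊥ := by
  induction β with
  | nil => rfl
  | cons α β ih => simp [S.map_bot, ih]

theorem act_mono (β : List L) {a b : B} (h : a ≤ b) : S.act β a ≤ S.act β b := by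
  rw [← inf_eq_left] at h ⊢
  rw [← S.act_inf, h]

/-- The ultrafilter `x` is the inverse image of the ultrafilter `y` under `θ_β`. -/
def Pull (β : List L) (x y : Ultra B) : Prop := ∀ a, a ∈ x ↔ S.act β a ∈ y

variable {S}

/-- An inverse image of an ultrafilter can only fail to be one by being empty, since `θ` need not be
unital; `a` excludes this. Thus paths can always be prolonged backwards, towards their range, from
points of `Z (S.act β a)`. -/
theorem exists_pull {β : List L} {y : Ultra B} {a : B} (ha : S.act β a ∈ y) :
    ∃ x, a ∈ x ∧ S.Pull β x y := by
  have hmax : Maximal IsFilter {a : B | S.act β a ∈ y} := by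
    refine IsFilter.maximal_of ⟨⟨a, ha⟩, ?_, fun {a b} ha hb => ?_,
      fun {a b} ha hab => y.mem_of_le ha (S.act_mono β hab)⟩ fun a ha b => ?_
    · rw [mem_ofPred_eq, S.act_bot]
      exact y.bot_notMem
    · rw [mem_ofPred_eq, S.act_inf]
      exact y.inf_mem ha hb
    · rw [mem_ofPred_eq, mem_ofPred_eq, S.act_sdiff]
      exact y.mem_or_sdiff_mem ha _
  exact ⟨⟨_, hmax⟩, ha, fun _ => Iff.rfl⟩

theorem pull_nil {x y : Ultra B} : S.Pull [] x y ↔ x = y :=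
  ⟨fun h => Ultra.ext_mem h, fun h _ => h ▸ Iff.rfl⟩

theorem Pull.append {β γ : List L} {x y z : Ultra B} (h : S.Pull β x y) (h' : S.Pull γ y z) :
    S.Pull (β ++ γ) x z := fun a => by rw [h, h', S.act_append]

theorem Pull.exists_of_append {β γ : List L} {x z : Ultra B} (h : S.Pull (β ++ γ) x z) :
    ∃ y, S.Pull β x y ∧ S.Pull γ y z := by
  obtain ⟨a, ha⟩ := x.nonempty
  rw [h, S.act_append] at ha
  obtain ⟨y, -, hy⟩ := exists_pull ha
  exact ⟨y, fun b => by rw [h, hy, S.act_append], hy⟩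

theorem Pull.left_unique {β : List L} {x x' y : Ultra B} (h : S.Pull β x y) (h' : S.Pull β x' y) :
    x = x' := Ultra.ext_mem fun a => by rw [h, h']

/-! ### Deterministic orbits and loops without entrances. -/

variable (S)

/-- The only edge with range `x` is the one with label `α` and domain `y`. -/
def UniqueStep (x : Ultra B) (α : L) (y : Ultra B) : Prop :=
  S.Pull [α] x y ∧ ∀ α' y', S.Pull [α'] x y' → α' = α ∧ y' = y

open Classical in
/-- The successor of an ultrafilter that is the range of a unique edge. -/
noncomputable def succ (x : Ultra B) : Ultra B :=
  if h : ∃ y α, S.UniqueStep x α y then h.choose else x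

/-- Every iterated successor of `x` is the range of a unique edge. -/
def IsPure (x : Ultra B) : Prop := ∀ i : ℕ, ∃ α y, S.UniqueStep (S.succ^[i] x) α y

/-- The base points of loops of length `n` without entrances. -/
def loopPoints (n : ℕ) : Set (Ultra B) := {x | S.IsPure x ∧ Function.IsPeriodicPt S.succ n x}

variable {S}

theorem UniqueStep.succ_eq {x y : Ultra B} {α : L} (h : S.UniqueStep x α y) : S.succ x = y := by
  have hex : ∃ y α, S.UniqueStep x α y := ⟨y, α, h⟩
  rw [succ, dif_pos hex]
  obtain ⟨α', h'⟩ := hex.choose_spec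
  exact (h.2 _ _ h'.1).2

theorem IsPure.exists_uniqueStep {x : Ultra B} (hx : S.IsPure x) :
    ∃ α, S.UniqueStep x α (S.succ x) := by
  obtain ⟨α, y, h⟩ := hx 0
  have h' : S.UniqueStep x α y := h
  exact ⟨α, h'.succ_eq ▸ h'⟩

theorem IsPure.iterate {x : Ultra B} (hx : S.IsPure x) (i : ℕ) : S.IsPure (S.succ^[i] x) := by
  intro j
  rw [← Function.iterate_add_apply]
  exact hx _

theorem IsPure.exists_pull {x : Ultra B} (hx : S.IsPure x) (n : ℕ) :
    ∃ β : List L, β.length = n ∧ S.Pull β x (S.succ^[n] x) := by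
  induction n generalizing x with
  | zero => exact ⟨[], rfl, pull_nil.2 rfl⟩
  | succ n ih =>
    obtain ⟨α, hα⟩ := hx.exists_uniqueStep
    obtain ⟨β, hβ, h⟩ := ih (hx.iterate 1)
    exact ⟨[α] ++ β, by simp [hβ], hα.1.append h⟩

/-- No choice occurs along a path that starts at a pure point, so its end depends on the length of
the word alone. -/
theorem IsPure.eq_iterate {x y : Ultra B} {β : List L} (hx : S.IsPure x) (h : S.Pull β x y) :
    y = S.succ^[β.length] x := by
  induction β generalizing x with
  | nil => exact (pull_nil.1 h).symm
  | cons α β ih =>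
    obtain ⟨z, h1, h2⟩ := h.exists_of_append (β := [α])
    obtain ⟨α', hα'⟩ := hx.exists_uniqueStep
    obtain rfl := (hα'.2 _ _ h1).2
    exact ih (hx.iterate 1) h2

theorem IsPure.right_unique {x y y' : Ultra B} {β : List L} (hx : S.IsPure x) (h : S.Pull β x y)
    (h' : S.Pull β x y') : y = y' := (hx.eq_iterate h).trans (hx.eq_iterate h').symm

theorem mem_loopPoints_iff {n : ℕ} (hn : 0 < n) {v : Ultra B} : v ∈ S.loopPoints n ↔
    ∃ x : ℕ → Ultra B, x 0 = v ∧ x n = v ∧ ∀ i < n, ∃ α, S.UniqueStep (x i) α (x (i + 1)) := by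
  constructor
  · rintro ⟨hv, hp⟩
    refine ⟨fun i => S.succ^[i] v, rfl, hp, fun i _ => ?_⟩
    simp only [Function.iterate_succ_apply']
    exact (hv.iterate i).exists_uniqueStep
  · rintro ⟨x, rfl, hxn, h⟩
    have key : ∀ i ≤ n, S.succ^[i] (x 0) = x i := by
      intro i hi
      induction i with
      | zero => rfl
      | succ i ih =>
        obtain ⟨α, hα⟩ := h i hi
        rw [Function.iterate_succ_apply', ih (by omega), hα.succ_eq]
    have hp : Function.IsPeriodicPt S.succ n (x 0) := (key n le_rfl).trans hxn
    refine ⟨fun i => ?_, hp⟩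
    have hlt := Nat.mod_lt i hn
    -- Purity concerns all iterates; periodicity reduces it to the `n` given steps.
    rw [← hp.iterate_mod_apply, key _ hlt.le]
    obtain ⟨α, hα⟩ := h _ hlt
    exact ⟨α, _, hα⟩

/-! ### A cycle with no exits consists of base points of loops without entrances -/

theorem HasNoExits.Δ_eq {β : List L} {hβ : β ≠ []} {A : B} (h : S.HasNoExits β hβ A)
    (hc : S.IsCycle β A) {t : ℕ} (ht : t < β.length) {b : B} (hb : b ≠ ⊥)
    (hbA : b ≤ S.act (β.take t) A) : S.Δ b = {β[t]} := by
  rcases Nat.eq_zero_or_pos t with rfl | h0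
  -- `HasNoExits` starts at `t = 1`; position `0` is covered by `t = β.length`, because `θ_β(A) =
  -- A`.
  · have := (h β.length ht le_rfl b hb (by rwa [List.take_length, ← hc.2.2 A le_rfl])).2
    simpa using this
  · have := (h t h0 ht.le b hb hbA).2
    simpa [Nat.mod_eq_of_lt ht] using this

theorem HasNoExits.eq_bot_of_act_drop {β : List L} {hβ : β ≠ []} {A : B}
    (h : S.HasNoExits β hβ A) (hc : S.IsCycle β A) {t : ℕ} (ht : t ≤ β.length) {b : B}
    (hbA : b ≤ S.act (β.take t) A) (h0 : S.act (β.drop t) b = ⊥) : b = ⊥ := by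
  induction ht using Nat.decreasingInduction generalizing b with
  | self => simpa using h0
  | of_succ t ht ih =>
    by_contra hb
    have hΔ : β[t] ∈ S.Δ b := by
      rw [h.Δ_eq hc ht hb hbA]
      rfl
    rw [List.drop_eq_getElem_cons ht, act_cons] at h0
    refine hΔ (ih ?_ h0)
    rw [List.take_succ_eq_append_getElem ht, S.act_append]
    exact S.θ_mono _ hbA

/-- Both sides have the same image under the rest of the word, as `θ_β` is the identity below `A`.
By `eq_bot_of_act_drop` the rest of the word kills no non-empty element here, so both differences
vanish. -/
theorem HasNoExits.act_act_drop {β : List L} {hβ : β ≠ []} {A : B}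
    (h : S.HasNoExits β hβ A) (hc : S.IsCycle β A) {t : ℕ} (ht : t ≤ β.length) {b : B}
    (hbA : b ≤ S.act (β.take t) A) : S.act (β.take t) (S.act (β.drop t) b) = b := by
  have hle : S.act (β.drop t) b ≤ A := by
    refine (S.act_mono _ hbA).trans ?_
    rw [← S.act_append, List.take_append_drop, ← hc.2.2 A le_rfl]
  have heq : S.act (β.drop t) (S.act (β.take t) (S.act (β.drop t) b)) = S.act (β.drop t) b := by
    rw [← S.act_append (β.take t), List.take_append_drop, ← hc.2.2 _ hle]
  refine le_antisymm ?_ ?_ <;> rw [← sdiff_eq_bot_iff] <;>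
    refine h.eq_bot_of_act_drop hc ht (sdiff_le.trans ?_) ?_
  · exact S.act_mono _ hle
  · rw [S.act_sdiff, heq, _root_.sdiff_self]
  · exact hbA
  · rw [S.act_sdiff, heq, _root_.sdiff_self]

theorem HasNoExits.uniqueStep {β : List L} {hβ : β ≠ []} {A : B}
    (h : S.HasNoExits β hβ A) (hc : S.IsCycle β A) {t : ℕ} (ht : t < β.length) {x y : Ultra B}
    (hx : S.act (β.take t) A ∈ x) (hxy : S.Pull [β[t]] x y) : S.UniqueStep x β[t] y := by
  refine ⟨hxy, fun α y' hxy' => ?_⟩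
  obtain rfl : α = β[t] := by
    have : α ∈ S.Δ (S.act (β.take t) A) := Ultra.ne_bot_of_mem ((hxy' _).1 hx)
    rwa [h.Δ_eq hc ht (Ultra.ne_bot_of_mem hx) le_rfl] at this
  refine ⟨rfl, Ultra.eq_of_forall_mem fun b hb => ?_⟩
  have heq : S.act (β.take (t + 1)) A = S.act [β[t]] (S.act (β.take t) A) := by
    rw [List.take_succ_eq_append_getElem ht, S.act_append]
  have hb' : b ⊓ S.act (β.take (t + 1)) A ∈ y' :=
    y'.inf_mem hb (heq ▸ (hxy' _).1 hx)
  refine y.mem_of_le ?_ (inf_le_left (b := S.act (β.take (t + 1)) A))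
  -- Elements below `S.act (β.take (t + 1)) A` are values of `θ` at the letter `β[t]`, so their
  -- membership in `y` and in `y'` is decided by `x`.
  rw [← h.act_act_drop hc ht inf_le_right, List.take_succ_eq_append_getElem ht,
    S.act_append] at hb' ⊢
  exact (hxy _).1 ((hxy' _).2 hb')

theorem HasNoExits.mem_loopPoints {β : List L} {hβ : β ≠ []} {A : B}
    (h : S.HasNoExits β hβ A) (hc : S.IsCycle β A) {v : Ultra B} (hv : A ∈ v) :
    v ∈ S.loopPoints β.length := by
  have hex : ∀ i, ∃ x, S.act (β.take i) A ∈ x ∧ S.Pull (β.drop i) x v := fun i =>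
    exists_pull (by rwa [← S.act_append, List.take_append_drop, ← hc.2.2 A le_rfl])
  -- The vertices of the loop are the inverse images of `v` under the final segments of `β`.
  choose x hx hxv using hex
  refine (mem_loopPoints_iff (List.length_pos_of_ne_nil hβ)).2 ⟨x, ?_, ?_, fun i hi => ?_⟩
  · refine Ultra.eq_of_forall_mem fun b hb => ?_
    have hb' := (hxv 0 _).1 ((x 0).inf_mem hb (hx 0))
    rw [List.drop_zero, List.take_zero, act_nil, ← hc.2.2 _ inf_le_right] at hb'
    exact v.mem_of_le hb' inf_le_left
  · exact pull_nil.1 (by simpa using hxv β.length)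
  · refine ⟨β[i], h.uniqueStep hc hi (hx i) ?_⟩
    have h1 := hxv i
    rw [List.drop_eq_getElem_cons hi] at h1
    obtain ⟨y, hy, hyv⟩ := h1.exists_of_append (β := [β[i]])
    rwa [(hxv (i + 1)).left_unique hyv]

/-! ### From an open set of base points to a cycle with no exits -/

/-- A limit `w` has some period, and it must be shown that `k` is one too. Nearby points of period
`k` are traced backwards along the orbit of `w` to points of `Z A`; these are periodic as well, so
they inherit the period `k`. -/
theorem isClosed_loopPoints_inter_Z {A : B} (hA : ∀ x ∈ Z A, ∃ n, 0 < n ∧ x ∈ S.loopPoints n)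
    (k : ℕ) : IsClosed (S.loopPoints k ∩ Z A) := by
  refine isClosed_of_closure_subset fun w hw => ?_
  have hwA : w ∈ Z A := (isClosed_Z A).closure_subset_iff.2 inter_subset_right hw
  refine ⟨?_, hwA⟩
  obtain ⟨m, hm, hwp, hwm⟩ := hA w hwA
  obtain ⟨m, rfl⟩ := Nat.exists_eq_add_of_lt hm
  refine ⟨hwp, ?_⟩
  simp only [zero_add] at hwm
  -- Here `m + 1` is a period of `w`, so `(m + 1) * k` steps lead back to `w`.
  have hreturn : S.succ^[k] (S.succ^[m * k] w) = w := by
    rw [← Function.iterate_add_apply, show k + m * k = (m + 1) * k by ring]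
    exact hwm.mul_const k
  obtain ⟨δ, hδ, hδw⟩ := hwp.exists_pull (m * k)
  obtain ⟨β, hβ, hβw⟩ := (hwp.iterate (m * k)).exists_pull k
  rw [hreturn] at hβw
  suffices S.succ^[m * k] w = w by
    rw [this] at hreturn
    exact hreturn
  symm
  refine Ultra.eq_of_forall_mem fun D hD => ?_
  by_contra hDu
  rw [hβw] at hDu
  have hδA : S.act β (S.act δ A) ∈ w := (hβw _).1 ((hδw _).1 hwA)
  -- Every point of this neighbourhood of `w` contains `D` but not `S.act β D`, and is reached from
  -- `Z A` along `δ` followed by `β`.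
  have hN := w.inf_mem hD ((w.mem_or_sdiff_mem hδA (S.act β D)).resolve_left hDu)
  obtain ⟨y, hyN, ⟨hyp, hyk⟩, -⟩ := mem_closure_iff.1 hw _ (isOpen_Z _) hN
  have hyD : D ∈ y := y.mem_of_le hyN inf_le_left
  have hyA : S.act β (S.act δ A) ∈ y := y.mem_of_le hyN (inf_le_right.trans sdiff_le)
  obtain ⟨u, huA, huy⟩ := exists_pull hyA
  obtain ⟨x, hxA, hxu⟩ := exists_pull huA
  obtain ⟨l, hl, hxp, hxl⟩ := hA x hxA
  have hux : u = S.succ^[m * k] x := hδ ▸ hxp.eq_iterate hxu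
  have hyx : y = S.succ^[(m + 1) * k] x := by
    have := hxp.eq_iterate (hxu.append huy)
    rwa [List.length_append, hδ, hβ, show m * k + k = (m + 1) * k by ring] at this
  -- As `x` is periodic with period `l`, it lies on the forward orbit of `y` and hence has period
  -- `k`, like `y`. Then `x`, `u` and `y` coincide.
  have hxy : S.succ^[l * ((m + 1) * k) - (m + 1) * k] y = x := by
    rw [hyx, ← Function.iterate_add_apply, Nat.sub_add_cancel (Nat.le_mul_of_pos_left _ hl)]
    exact hxl.mul_const _
  have hxk : Function.IsPeriodicPt S.succ k x := hxy ▸ hyk.apply_iterate _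
  have huy' : u = y := by
    rw [hux, hyx, (hxk.const_mul m).eq, (hxk.const_mul (m + 1)).eq]
  subst huy'
  exact Ultra.sdiff_notMem ((huy _).1 hyD) (u.mem_of_le hyN inf_le_right)

theorem exists_Z_subset_loopPoints {A : B} (hA0 : A ≠ ⊥)
    (hA : ∀ x ∈ Z A, ∃ n, 0 < n ∧ x ∈ S.loopPoints n) :
    ∃ k, 0 < k ∧ ∃ A', A' ≠ ⊥ ∧ Z A' ⊆ S.loopPoints k := by
  have hdense := dense_iUnion_interior_of_closed
    -- Adding the complement of `Z A` makes the closed sets cover the whole space; the shift keeps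
    -- the periods positive.
    (f := fun k : ℕ => S.loopPoints (k + 1) ∩ Z A ∪ (Z A)ᶜ)
    (fun k => (isClosed_loopPoints_inter_Z hA _).union (isOpen_Z A).isClosed_compl)
    (by
      refine eq_univ_of_forall fun x => mem_iUnion.2 ?_
      by_cases hx : x ∈ Z A
      · obtain ⟨n, hn, hxn⟩ := hA x hx
        obtain ⟨n, rfl⟩ := Nat.exists_eq_add_of_lt hn
        exact ⟨n, Or.inl ⟨by simpa using hxn, hx⟩⟩
      · exact ⟨0, Or.inr hx⟩)
  obtain ⟨x, hxA, hx⟩ := hdense.inter_open_nonempty _ (isOpen_Z A) (exists_ultra_mem hA0)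
  obtain ⟨k, hk⟩ := mem_iUnion.1 hx
  obtain ⟨_, ⟨A', rfl⟩, hxA', hsub⟩ := isTopologicalBasis_Z.exists_subset_of_mem_open
    (show x ∈ interior _ ∩ Z A from ⟨hk, hxA⟩) (isOpen_interior.inter (isOpen_Z A))
  refine ⟨k + 1, k.succ_pos, A', Ultra.ne_bot_of_mem hxA', fun y hy => ?_⟩
  exact ((interior_subset (hsub hy).1).resolve_right fun h => h (hsub hy).2).1

theorem exists_pull_self {k : ℕ} {A : B} (hA0 : A ≠ ⊥) (hA : Z A ⊆ S.loopPoints k) :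
    ∃ β : List L, β.length = k ∧ ∃ A', A' ≠ ⊥ ∧ ∀ x ∈ Z A', S.IsPure x ∧ S.Pull β x x := by
  obtain ⟨w, hw⟩ := exists_ultra_mem hA0
  obtain ⟨hwp, hwk⟩ := hA hw
  obtain ⟨β, hβ, hβw⟩ := hwp.exists_pull k
  rw [hwk] at hβw
  -- The factor `S.act β A` puts the inverse image of `x` under `θ_β` into `Z A`; it therefore has
  -- period `k`, and `k` steps from it lead both to itself and to `x`.
  refine ⟨β, hβ, A ⊓ S.act β A, Ultra.ne_bot_of_mem (w.inf_mem hw ((hβw _).1 hw)),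
    fun x hx => ?_⟩
  obtain ⟨y, hy, hyx⟩ := exists_pull (x.mem_of_le hx inf_le_right)
  obtain ⟨hyp, hyk⟩ := hA hy
  have : x = y := by rw [hyp.eq_iterate hyx, hβ, hyk]
  subst this
  exact ⟨hyp, hyx⟩

theorem isCycle_of_pull_self {β : List L} (hβ : β ≠ []) {A : B} (hA0 : A ≠ ⊥)
    (hA : ∀ x ∈ Z A, S.IsPure x ∧ S.Pull β x x) : S.IsCycle β A := by
  refine ⟨hβ, hA0, fun b hb => le_antisymm ?_ ?_⟩ <;> refine le_of_forall_ultra fun x hx => ?_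
  · exact ((hA x (x.mem_of_le hx hb)).2 b).1 hx
  -- It is not known that `x` lies in `Z A`, but its inverse image `y` does; `β` leads from `y` to
  -- `y` and to `x`, so they agree.
  · obtain ⟨y, hy, hyx⟩ := exists_pull hx
    obtain ⟨hyp, hyy⟩ := hA y (y.mem_of_le hy hb)
    rwa [hyp.right_unique hyx hyy]

theorem Δ_eq_of_uniqueStep {b : B} (hb : b ≠ ⊥) {α : L}
    (h : ∀ x ∈ Z b, ∃ y, S.UniqueStep x α y) : S.Δ b = {α} := by
  ext α'
  constructor
  · intro hα'
    obtain ⟨y, hy⟩ := exists_ultra_mem hα'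
    obtain ⟨x, hx, hxy⟩ := exists_pull (S := S) (β := [α']) hy
    obtain ⟨z, hz⟩ := h x hx
    exact (hz.2 _ _ hxy).1
  · rintro rfl
    obtain ⟨x, hx⟩ := exists_ultra_mem hb
    obtain ⟨y, hy⟩ := h x hx
    exact Ultra.ne_bot_of_mem ((hy.1 _).1 hx)

theorem hasNoExits_of_pull_self {β : List L} (hβ : β ≠ []) {A : B}
    (hA : ∀ x ∈ Z A, S.IsPure x ∧ S.Pull β x x) : S.HasNoExits β hβ A := by
  intro t _ ht b hb hbA
  have hlt := Nat.mod_lt t (List.length_pos_of_ne_nil hβ)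
  have key : ∀ b', b' ≠ ⊥ → b' ≤ b → S.Δ b' = {β[t % β.length]} := by
    intro b' hb' hle
    refine Δ_eq_of_uniqueStep hb' fun ω hω => ?_
    -- Thus `ω` is the vertex reached after `t` steps on the loop at `x`, and its only edge carries
    -- the next letter of `β`.
    obtain ⟨x, hxA, hxω⟩ := exists_pull (ω.mem_of_le hω (hle.trans hbA))
    obtain ⟨hxp, hxx⟩ := hA x hxA
    have hωp : S.IsPure ω := hxp.eq_iterate hxω ▸ hxp.iterate _
    suffices ∃ y, S.Pull [β[t % β.length]] ω y by
      obtain ⟨y, hy⟩ := this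
      obtain ⟨α, hα⟩ := hωp.exists_uniqueStep
      rw [(hα.2 _ _ hy).1]
      exact ⟨_, hα⟩
    rcases ht.lt_or_eq with ht | rfl
    · rw [← List.take_append_drop t β] at hxx
      obtain ⟨ω', h1, h2⟩ := hxx.exists_of_append
      rw [← hxp.right_unique hxω h1, List.drop_eq_getElem_cons ht] at h2
      obtain ⟨y, hy, -⟩ := h2.exists_of_append (β := [β[t]])
      exact ⟨y, by simpa [Nat.mod_eq_of_lt ht] using hy⟩
    -- For `t = β.length` the loop has closed, so `ω = x` and the next letter is `β[0]`.
    · rw [List.take_length] at hxω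
      obtain rfl := hxp.right_unique hxω hxx
      have h0 := List.length_pos_of_ne_nil hβ
      rw [← List.drop_zero (l := β), List.drop_eq_getElem_cons h0] at hxx
      obtain ⟨y, hy, -⟩ := hxx.exists_of_append (β := [β[0]])
      exact ⟨y, by simpa using hy⟩
  refine ⟨fun b' hb' hle => ?_, key b hb le_rfl⟩
  rw [key b' hb' hle]
  exact ⟨singleton_nonempty _, finite_singleton _⟩

variable (S) in
theorem conditionL_iff :
    S.ConditionL ↔ interior {x | ∃ n, 0 < n ∧ x ∈ S.loopPoints n} = ∅ := by
  rw [ConditionL, not_iff_comm, ← ne_eq, ← nonempty_iff_ne_empty]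
  constructor
  · rintro ⟨x, hx⟩
    obtain ⟨_, ⟨A, rfl⟩, hxA, hsub⟩ :=
      isTopologicalBasis_Z.exists_subset_of_mem_open hx isOpen_interior
    obtain ⟨k, hk, A', hA', hsub'⟩ := exists_Z_subset_loopPoints (Ultra.ne_bot_of_mem hxA)
      fun x hx => show x ∈ {x | ∃ n, 0 < n ∧ x ∈ S.loopPoints n} from interior_subset (hsub hx)
    obtain ⟨β, rfl, A'', hA'', h⟩ := exists_pull_self hA' hsub'
    have hβ := List.ne_nil_of_length_pos hk
    exact ⟨β, hβ, A'', isCycle_of_pull_self hβ hA'' h, hasNoExits_of_pull_self hβ h⟩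
  · rintro ⟨β, hβ, A, hc, h⟩
    obtain ⟨x, hx⟩ := exists_ultra_mem hc.2.1
    exact ⟨x, mem_interior.2 ⟨Z A, fun y hy => ⟨_, List.length_pos_of_ne_nil hβ,
      h.mem_loopPoints hc hy⟩, isOpen_Z A, hx⟩⟩

end BooleanDynamicalSystem

/-! ### Translation to the edges and loops of the graph. -/

namespace GeneralizedBooleanDynamicalSystem

variable {B : Type*} {L : Type*} [GeneralizedBooleanAlgebra B]
  (S : GeneralizedBooleanDynamicalSystem B L)

theorem pull_pullback (e : S.dom) : S.Pull [e.1.label] (S.pullback e) (S.extend e.1.ultra) :=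
  fun a => (S.mem_extend_iff e.1.ultra (S.θI e.1.label a)).symm

/-- For `a ∈ x` the element `θ_α(a)` lies in `y` and in `R_α ⊆ I_α`, so `y` restricts to an
ultrafilter of `I_α` whose edge is in the domain of `r`. -/
theorem exists_edge_of_pull {α : L} {x y : Ultra B} (h : S.Pull [α] x y) :
    ∃ e : S.dom, e.1.label = α ∧ S.pullback e = x ∧ S.extend e.1.ultra = y := by
  obtain ⟨a, ha⟩ := x.nonempty
  obtain ⟨η, hη, rfl⟩ := S.exists_extend_eq y (S.θI α a) ((h a).1 ha)
  have hdom : (⟨α, η⟩ : S.Edge) ∈ S.dom := ⟨_, hη, a, le_rfl⟩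
  exact ⟨⟨⟨α, η⟩, hdom⟩, rfl, (S.pull_pullback ⟨_, hdom⟩).left_unique h, rfl⟩

theorem edge_ext {e f : S.Edge} (h : e.label = f.label)
    (h' : S.extend e.ultra = S.extend f.ultra) : e = f := by
  obtain ⟨α, η⟩ := e
  obtain ⟨α', ξ⟩ := f
  obtain rfl : α = α' := h
  exact congrArg (Edge.mk α) (S.extend_injective h')

theorem pullback_fiber_eq_singleton_iff (e : S.dom) :
    Subtype.val '' (S.pullback ⁻¹' {S.pullback e}) = {e.1} ↔
      S.UniqueStep (S.pullback e) e.1.label (S.extend e.1.ultra) := by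
  constructor
  · refine fun h => ⟨S.pull_pullback e, fun α y hy => ?_⟩
    obtain ⟨f, rfl, hf, rfl⟩ := S.exists_edge_of_pull hy
    have hfe : f.1 = e.1 := h.subset ⟨f, hf, rfl⟩
    rw [hfe]
    exact ⟨rfl, rfl⟩
  · refine fun h => Set.Subset.antisymm ?_ ?_
    · rintro _ ⟨f, hf, rfl⟩
      have hf' : S.pullback f = S.pullback e := hf
      obtain ⟨h1, h2⟩ := h.2 _ _ (hf' ▸ S.pull_pullback f)
      exact S.edge_ext h1 h2
    · rintro _ rfl
      exact ⟨e, rfl, rfl⟩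

theorem basePoints_graph :
    S.graph.basePoints = {x | ∃ n, 0 < n ∧ x ∈ S.loopPoints n} := by
  ext v
  constructor
  · rintro ⟨n, e, ⟨hpath, ⟨h0, hr⟩, hd⟩, hwe⟩
    refine ⟨n + 1, n.succ_pos, (BooleanDynamicalSystem.mem_loopPoints_iff n.succ_pos).2 ?_⟩
    choose hdom hfib using hwe
    replace hdom : ∀ k, e k ∈ S.dom := hdom
    -- The vertices are the ranges of the edges; the default `v` matters at `i = n + 1`, where it is
    -- the domain of the last edge.
    refine ⟨fun i => if h : i < n + 1 then S.pullback ⟨e ⟨i, h⟩, hdom _⟩ else v, ?_, by simp,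
      fun i hi => ⟨(e ⟨i, hi⟩).label, ?_⟩⟩
    · exact (dif_pos n.succ_pos).trans hr
    · have hu := (S.pullback_fiber_eq_singleton_iff ⟨e ⟨i, hi⟩, hdom _⟩).1 (hfib _)
      have hnext : (if h : i + 1 < n + 1 then S.pullback ⟨e ⟨i + 1, h⟩, hdom _⟩ else v) =
          S.extend (e ⟨i, hi⟩).ultra := by
        split_ifs with h
        · obtain ⟨h1, h2⟩ := hpath ⟨i, by omega⟩
          exact h2.symm
        · obtain rfl : i = n := by omega
          exact hd.symm
      simp only [dif_pos hi, hnext]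
      exact hu
  · rintro ⟨n, hn, hv⟩
    obtain ⟨n, rfl⟩ := Nat.exists_eq_add_of_lt hn
    obtain ⟨x, rfl, hxn, h⟩ := (BooleanDynamicalSystem.mem_loopPoints_iff hn).1 hv
    rw [zero_add] at hxn h
    choose α hα using h
    have hex := fun i hi => S.exists_edge_of_pull (hα i hi).1
    choose e hlabel hr hd using hex
    refine ⟨n, fun i => (e i i.2).1, ⟨fun i => ⟨(e _ _).2, ?_⟩, ⟨(e _ _).2, hr _ _⟩,
      (hd _ _).trans hxn⟩, fun i => ⟨(e _ _).2, (S.pullback_fiber_eq_singleton_iff _).2 ?_⟩⟩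
    · exact (hd _ _).trans (hr _ _).symm
    · have := hα i i.2
      rw [← hlabel i i.2, ← hr i i.2, ← hd i i.2] at this
      exact this

end GeneralizedBooleanDynamicalSystem

end BoolDyn

theorem mainTheorem6 {B : Type*} {L : Type*} [GeneralizedBooleanAlgebra B]
    (S : BoolDyn.GeneralizedBooleanDynamicalSystem B L) :
    S.toBooleanDynamicalSystem.ConditionL ↔ S.graph.TopologicallyFree := by
  rw [BoolDyn.PartialTopologicalGraph.TopologicallyFree, S.basePoints_graph]
  exact S.toBooleanDynamicalSystem.conditionL_iff
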